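/- Let $(E_n)_{n\in\mathbb Z}$ be Euclidean spaces (finite-dimensional real inner product spaces) of the same dimension $m$, and let $\mathcal A=\{A_n:E_n\to E_{n+1}\}_{n\in\mathbb Z}$ be linear isomorphisms such that, for some $R>0$, $\|A_n\|<R$ and $\|A_n^{-1}\|<R$ for all $n\in\mathbb Z$. For $\gamma\ge 0$ write $\mathcal A\in\mathrm{SG}(\gamma)$ if there is a constant $L>0$ such that for all $i\in\mathbb Z$, all integers $N>0$ and every sequence $w_k\in E_k$, $k\in[i+1,i+N]$, with $|w_k|\le 1$, there is a sequence $v_k\in E_k$, $k\in[i,i+N]$, with $$v_{k+1}=A_kv_k+w_{k+1}\ \ (i\le k\le i+N-1),\qquad |v_k|\le L N^{\gamma}\ \ (i\le k\le i+N).$$ $\mathcal A$ has the sublinear growth property if $\mathcal A\in \mathrm{SG}(\gamma)$ for some $\gamma\in[0,1)$, and the bounded solution property if $\mathcal A\in \mathrm{SG}(0)$. $\mathcal A$ has exponential dichotomy on $\mathbb Z^+$ if there are $C>0$, $\lambda\in(0,1)$ and decompositions $E_k=E_k^{s,+}\oplus E_k^{u,+}$, $k\ge 0$, with $E_{k+1}^{\sigma,+}=A_kE_k^{\sigma,+}$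 for $k\ge0$, $\sigma\in\{s,u\}$, such that for all $k\ge 0$, $l>0$ $$|A_{k+l-1}\cdots A_kv|\le C\lambda^l|v|\ \ (v\in E_k^{s,+}),\qquad |A_{k+l-1}\cdots A_kv|\ge \tfrac1C\lambda^{-l}|v|\ \ (v\in E_k^{u,+}).$$ $\mathcal A$ has exponential dichotomy on $\mathbb Z^-$ if there are $C>0$, $\lambda\in(0,1)$ and decompositions $E_k=E_k^{s,-}\oplus E_k^{u,-}$, $k\le 0$, with $E_{k+1}^{\sigma,-}=A_kE_k^{\sigma,-}$ for $k<0$, $\sigma\in\{s,u\}$, such that the same two inequalities hold for $v\in E_k^{s,-}$ and $v\in E_k^{u,-}$ respectively, for all $l>0$ and $k$ with $k+l<0$. Theorem. If $\mathcal A$ has the sublinear growth property, then $\mathcal A$ has exponential dichotomy on both $\mathbb Z^+$ and $\mathbb Z^-$, and the corresponding subspaces (for every choice of the decompositions) satisfy $E_0^{s,+}+E_0^{u,-}=E_0$. Consequently, $\mathcal A$ has the sublinear growth property if and only if it has the bounded solution property. -/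

import Mathlib

namespace LinSeq

theorem cast_apply_eq {F : ℤ → Type*} (x : ∀ n : ℤ, F n) {a b : ℤ} (h : a = b) :
    cast (congrArg F h) (x a) = x b := by
  subst h; rfl

variable {E : ℤ → Type*} [∀ n, NormedAddCommGroup (E n)] [∀ n, InnerProductSpace ℝ (E n)]

/-- The slow growth property `SG(γ)`: for every window `[i, i + N]` and every inhomogeneity `w` with
`‖w k‖ ≤ 1` on `[i + 1, i + N]`, the equation `v (k + 1) = A k (v k) + w (k + 1)` has a solution on
the window bounded by `L * N ^ γ`. (Values of `w`, `v` outside of the windows play no role.) -/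
def SlowGrowth (A : ∀ n : ℤ, E n ≃L[ℝ] E (n + 1)) (γ : ℝ) : Prop :=
  ∃ L : ℝ, 0 < L ∧ ∀ (i : ℤ) (N : ℕ), 0 < N →
    ∀ w : ∀ k : ℤ, E k, (∀ k ∈ Set.Icc (i + 1) (i + N), ‖w k‖ ≤ 1) →
      ∃ v : ∀ k : ℤ, E k,
        (∀ k ∈ Set.Icc i (i + N - 1), v (k + 1) = A k (v k) + w (k + 1)) ∧
        (∀ k ∈ Set.Icc i (i + N), ‖v k‖ ≤ L * (N : ℝ) ^ γ)

/-- The sublinear growth property: `SG(γ)` for some `γ ∈ [0, 1)`. -/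
def SublinearGrowth (A : ∀ n : ℤ, E n ≃L[ℝ] E (n + 1)) : Prop :=
  ∃ γ : ℝ, 0 ≤ γ ∧ γ < 1 ∧ SlowGrowth A γ

/-- The bounded solution property: `SG(0)`. -/
def BoundedSolution (A : ∀ n : ℤ, E n ≃L[ℝ] E (n + 1)) : Prop :=
  SlowGrowth A 0

/-- The product `A (k + l - 1) ⋯ A k : E k → E (k + l)`; the casts only identify equal indices. -/
def transition (A : ∀ n : ℤ, E n ≃L[ℝ] E (n + 1)) (k : ℤ) : (l : ℕ) → E k → E (k + (l : ℤ))
  | 0, x => cast (congrArg E (by simp)) x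
  | l + 1, x => cast (congrArg E (by push_cast; ring)) (A (k + (l : ℤ)) (transition A k l x))

/-- Along a trajectory, `transition` is the passage from `x k` to `x (k + l)`. -/
theorem transition_trajectory (A : ∀ n : ℤ, E n ≃L[ℝ] E (n + 1)) (x : ∀ n : ℤ, E n) (k : ℤ)
    (l : ℕ) (hx : ∀ j : ℤ, k ≤ j → j < k + l → x (j + 1) = A j (x j)) :
    transition A k l (x k) = x (k + (l : ℤ)) := by
  induction l with
  | zero => exact cast_apply_eq x (by simp)
  | succ l ih =>
    have h1 := ih (fun j h1 h2 => hx j h1 (by push_cast; omega))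
    rw [transition, h1, ← hx (k + l) (by omega) (by push_cast; omega)]
    exact cast_apply_eq x (by push_cast; ring)

/-- `s`, `u` (restricted to `k ≥ 0`) are the stable and unstable subspaces of an exponential
dichotomy of `A` on `ℤ⁺`. -/
def IsDichotomyPlus (A : ∀ n : ℤ, E n ≃L[ℝ] E (n + 1)) (s u : ∀ k : ℤ, Submodule ℝ (E k)) :
    Prop :=
  ∃ C lam : ℝ, 0 < C ∧ 0 < lam ∧ lam < 1 ∧
    (∀ k : ℤ, 0 ≤ k → IsCompl (s k) (u k)) ∧
    (∀ k : ℤ, 0 ≤ k → s (k + 1) = (s k).map (A k).toLinearEquiv.toLinearMap) ∧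
    (∀ k : ℤ, 0 ≤ k → u (k + 1) = (u k).map (A k).toLinearEquiv.toLinearMap) ∧
    (∀ (k : ℤ) (l : ℕ), 0 ≤ k → 0 < l → ∀ x ∈ s k, ‖transition A k l x‖ ≤ C * lam ^ l * ‖x‖) ∧
    (∀ (k : ℤ) (l : ℕ), 0 ≤ k → 0 < l → ∀ x ∈ u k,
      1 / C * (lam ^ l)⁻¹ * ‖x‖ ≤ ‖transition A k l x‖)

/-- `s`, `u` (restricted to `k ≤ 0`) are the stable and unstable subspaces of an exponential
dichotomy of `A` on `ℤ⁻`. -/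
def IsDichotomyMinus (A : ∀ n : ℤ, E n ≃L[ℝ] E (n + 1)) (s u : ∀ k : ℤ, Submodule ℝ (E k)) :
    Prop :=
  ∃ C lam : ℝ, 0 < C ∧ 0 < lam ∧ lam < 1 ∧
    (∀ k : ℤ, k ≤ 0 → IsCompl (s k) (u k)) ∧
    (∀ k : ℤ, k < 0 → s (k + 1) = (s k).map (A k).toLinearEquiv.toLinearMap) ∧
    (∀ k : ℤ, k < 0 → u (k + 1) = (u k).map (A k).toLinearEquiv.toLinearMap) ∧
    (∀ (k : ℤ) (l : ℕ), 0 < l → k + l < 0 → ∀ x ∈ s k,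
      ‖transition A k l x‖ ≤ C * lam ^ l * ‖x‖) ∧
    (∀ (k : ℤ) (l : ℕ), 0 < l → k + l < 0 → ∀ x ∈ u k,
      1 / C * (lam ^ l)⁻¹ * ‖x‖ ≤ ‖transition A k l x‖)

/-- `A` has exponential dichotomy on `ℤ⁺`. -/
def ExpDichotomyPlus (A : ∀ n : ℤ, E n ≃L[ℝ] E (n + 1)) : Prop :=
  ∃ s u : ∀ k : ℤ, Submodule ℝ (E k), IsDichotomyPlus A s u

/-- `A` has exponential dichotomy on `ℤ⁻`. -/
def ExpDichotomyMinus (A : ∀ n : ℤ, E n ≃L[ℝ] E (n + 1)) : Prop :=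
  ∃ s u : ∀ k : ℤ, Submodule ℝ (E k), IsDichotomyMinus A s u

end LinSeq

/-! Let `X` be a fundamental solution and `Y = (X*)⁻¹` the adjoint system, so that `⟪Y k y, X k x⟫`
does not depend on `k`. Feed the normalized adjoint trajectory `Y k x / ‖Y k x‖` into the equation
as inhomogeneity: pairing the slow solution with `Y k x` telescopes, and the sum of `‖Y k x‖` inside
a window of length `N` is at most `L N ^ γ` times the sum of its two end values
(`SlowGrowth.exists_sum_le`). Since `γ < 1`, for `N = 2n` with `n` large the factor is at most `n /
4`, and the sums `B j` over blocks of length `n` satisfy `B (j+1) ≤ (B j + B (j+2)) / 4`.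

Such a sequence either decreases geometrically, or increases geometrically once it has increased. In
finite dimension this gives dichotomies of `Y` on both half-lines (`dichotomy_of_noncritical`), and
orthogonal complements carry them to `X` (`Dichotomy.orthogonal`). No nonzero adjoint trajectory is
bounded on all of `ℤ`, which dually says that the stable space of `ℤ⁺` and the unstable space of
`ℤ⁻` span (`SlowGrowth.exists_dichotomies`). This transversality splits every impulse into a forward
decaying and a backward decaying part, and summing the responses gives bounded solutions
(`boundedSolution_of_splitting`). -/

namespace LinSeq

/-! ### Scalar sequences: block sums and the inequality `B (j+1) ≤ (B j + B (j+2)) / 4`. -/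

section Scalar

/-- The sum of `b` over the `j`-th block of length `n`. -/
def blockSum (b : ℕ → ℝ) (n j : ℕ) : ℝ := ∑ k ∈ Finset.Ico (j * n) ((j + 1) * n), b k

theorem blockSum_nonneg {b : ℕ → ℝ} (hb : ∀ k, 0 ≤ b k) (n j : ℕ) : 0 ≤ blockSum b n j :=
  Finset.sum_nonneg fun k _ => hb k

theorem blockSum_eq_sum_range (b : ℕ → ℝ) (n j : ℕ) :
    blockSum b n j = ∑ r ∈ Finset.range n, b (j * n + r) := by
  rw [blockSum, Finset.sum_Ico_eq_sum_range]
  congr 2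
  rw [add_mul, one_mul, Nat.add_sub_cancel_left]

theorem le_pow_mul_forward {b : ℕ → ℝ} {R : ℝ} (hR : 1 ≤ R) (h : ∀ k, b (k + 1) ≤ R * b k)
    (k l : ℕ) : b (k + l) ≤ R ^ l * b k := by
  induction l with
  | zero => simp
  | succ l ih =>
    calc b (k + (l + 1)) ≤ R * b (k + l) := h (k + l)
      _ ≤ R * (R ^ l * b k) := by gcongr
      _ = R ^ (l + 1) * b k := by ring

theorem le_pow_mul_backward {b : ℕ → ℝ} {R : ℝ} (hR : 1 ≤ R) (h : ∀ k, b k ≤ R * b (k + 1))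
    (k l : ℕ) : b k ≤ R ^ l * b (k + l) := by
  induction l with
  | zero => simp
  | succ l ih =>
    calc b k ≤ R ^ l * b (k + l) := ih
      _ ≤ R ^ l * (R * b (k + (l + 1))) := by gcongr; exact h (k + l)
      _ = R ^ (l + 1) * b (k + (l + 1)) := by ring

/-- Block `j + 1` lies in each of the `n` windows that start in block `j` and have length `2n`;
averaging over the starting point turns end values into block sums. -/
theorem blockSum_noncritical {b : ℕ → ℝ} (hb : ∀ k, 0 ≤ b k) {n : ℕ} (hn : 0 < n)
    (hw : ∀ i, ∑ k ∈ Finset.Ioo i (i + 2 * n), b k ≤ n / 4 * (b i + b (i + 2 * n))) (j : ℕ) :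
    blockSum b n (j + 1) ≤ 1 / 4 * (blockSum b n j + blockSum b n (j + 2)) := by
  have h1 : ∀ r ∈ Finset.range n, blockSum b n (j + 1) ≤
      n / 4 * (b (j * n + r) + b ((j + 2) * n + r)) := by
    intro r hr
    rw [Finset.mem_range] at hr
    have h2 := hw (j * n + r)
    have h3 : j * n + r + 2 * n = (j + 2) * n + r := by ring
    rw [h3] at h2
    refine le_trans ?_ h2
    refine Finset.sum_le_sum_of_subset_of_nonneg ?_ (fun k _ _ => hb k)
    intro k hk
    rw [Finset.mem_Ico] at hk
    rw [Finset.mem_Ioo]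
    have h4 : (j + 1) * n = j * n + n := by ring
    have h5 : (j + 1 + 1) * n = j * n + 2 * n := by ring
    omega
  have h2 := Finset.sum_le_sum h1
  rw [Finset.sum_const, Finset.card_range, nsmul_eq_mul, ← Finset.mul_sum,
    Finset.sum_add_distrib, ← blockSum_eq_sum_range, ← blockSum_eq_sum_range] at h2
  have hn' : (0 : ℝ) < n := by exact_mod_cast hn
  refine le_of_mul_le_mul_left (h2.trans_eq ?_) hn'
  ring

theorem le_blockSum {b : ℕ → ℝ} (hb : ∀ k, 0 ≤ b k) {n : ℕ} (hn : 0 < n) (k : ℕ) :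
    b k ≤ blockSum b n (k / n) := by
  refine Finset.single_le_sum (f := b) (fun i _ => hb i) ?_
  rw [Finset.mem_Ico]
  refine ⟨Nat.div_mul_le_self k n, ?_⟩
  rw [mul_comm]
  exact Nat.lt_mul_div_succ k hn

theorem blockSum_le {b : ℕ → ℝ} (hb : ∀ k, 0 ≤ b k) {R : ℝ} (hR : 1 ≤ R)
    (hf : ∀ k, b (k + 1) ≤ R * b k) (hg : ∀ k, b k ≤ R * b (k + 1)) {n : ℕ} (hn : 0 < n) (k : ℕ) :
    blockSum b n (k / n) ≤ n * R ^ n * b k := by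
  have h1 : ∀ i ∈ Finset.Ico (k / n * n) ((k / n + 1) * n), b i ≤ R ^ n * b k := by
    intro i hi
    rw [Finset.mem_Ico, add_mul, one_mul] at hi
    have h2 := Nat.div_mul_le_self k n
    have h3 : k < k / n * n + n := by
      have := Nat.lt_mul_div_succ k hn
      rw [mul_comm, add_mul, one_mul] at this
      exact this
    rcases le_total i k with h | h
    · obtain ⟨l, rfl⟩ := Nat.exists_eq_add_of_le h
      refine (le_pow_mul_backward hR hg i l).trans ?_
      have := hb (i + l)
      gcongr
      omega
    · obtain ⟨l, rfl⟩ := Nat.exists_eq_add_of_le h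
      refine (le_pow_mul_forward hR hf k l).trans ?_
      have := hb k
      gcongr
      omega
  refine (Finset.sum_le_sum h1).trans_eq ?_
  rw [Finset.sum_const, Nat.card_Ico, nsmul_eq_mul, add_mul, one_mul, Nat.add_sub_cancel_left]
  ring

/-- Converts a factor `1/2` per block into a rate per step; the incomplete blocks at the ends cost
the factor 2. -/
theorem pow_block_le {lam : ℝ} (h0 : 0 < lam) (h1 : lam < 1) {n : ℕ} (hlam : lam ^ n = 1 / 2)
    {i l : ℕ} (h : l ≤ n * i + n) : (1 / 2 : ℝ) ^ i ≤ 2 * lam ^ l := by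
  have h2 : lam ^ (n * i + n) ≤ lam ^ l := pow_le_pow_of_le_one h0.le h1.le h
  rw [pow_add, pow_mul, hlam] at h2
  linarith

theorem decay_of_blockSum {b : ℕ → ℝ} (hb : ∀ k, 0 ≤ b k) {R : ℝ} (hR : 1 ≤ R)
    (hf : ∀ k, b (k + 1) ≤ R * b k) (hg : ∀ k, b k ≤ R * b (k + 1)) {n : ℕ} (hn : 0 < n)
    {lam : ℝ} (h0 : 0 < lam) (h1 : lam < 1) (hlam : lam ^ n = 1 / 2)
    (hB : ∀ j, blockSum b n (j + 1) ≤ 1 / 2 * blockSum b n j) (k l : ℕ) :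
    b (k + l) ≤ 2 * n * R ^ n * lam ^ l * b k := by
  have h2 : ∀ j i, blockSum b n (j + i) ≤ (1 / 2) ^ i * blockSum b n j := by
    intro j i
    induction i with
    | zero => simp
    | succ i ih =>
      refine (hB (j + i)).trans ?_
      rw [pow_succ]
      linarith
  obtain ⟨i, hi⟩ := Nat.exists_eq_add_of_le (Nat.div_le_div_right (c := n) (Nat.le_add_right k l))
  have h3 : l ≤ n * i + n := by
    have h4 := Nat.lt_mul_div_succ (k + l) hn
    have h5 := Nat.mul_div_le k n
    rw [hi, mul_add, mul_add, mul_one] at h4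
    omega
  calc b (k + l) ≤ blockSum b n (k / n + i) := hi ▸ le_blockSum hb hn (k + l)
    _ ≤ (1 / 2) ^ i * blockSum b n (k / n) := h2 _ _
    _ ≤ (2 * lam ^ l) * (n * R ^ n * b k) := by
      have := blockSum_nonneg hb n (k / n)
      exact mul_le_mul (pow_block_le h0 h1 hlam h3) (blockSum_le hb hR hf hg hn k) this
        (by positivity)
    _ = _ := by ring

theorem growth_of_blockSum {b : ℕ → ℝ} (hb : ∀ k, 0 ≤ b k) {R : ℝ} (hR : 1 ≤ R)
    (hf : ∀ k, b (k + 1) ≤ R * b k) (hg : ∀ k, b k ≤ R * b (k + 1)) {n : ℕ} (hn : 0 < n)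
    {lam : ℝ} (h0 : 0 < lam) (h1 : lam < 1) (hlam : lam ^ n = 1 / 2) {J : ℕ}
    (hB : ∀ j, J ≤ j → blockSum b n j ≤ 1 / 2 * blockSum b n (j + 1)) (k l : ℕ) (hk : J * n ≤ k) :
    b k ≤ 2 * n * R ^ n * lam ^ l * b (k + l) := by
  have h2 : ∀ j i, J ≤ j → blockSum b n j ≤ (1 / 2) ^ i * blockSum b n (j + i) := by
    intro j i hj
    induction i with
    | zero => simp
    | succ i ih =>
      refine ih.trans ?_
      rw [pow_succ, mul_assoc]
      gcongr
      exact hB (j + i) (by omega)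
  obtain ⟨i, hi⟩ := Nat.exists_eq_add_of_le (Nat.div_le_div_right (c := n) (Nat.le_add_right k l))
  have h3 : l ≤ n * i + n := by
    have h4 := Nat.lt_mul_div_succ (k + l) hn
    have h5 := Nat.mul_div_le k n
    rw [hi, mul_add, mul_add, mul_one] at h4
    omega
  calc b k ≤ blockSum b n (k / n) := le_blockSum hb hn k
    _ ≤ (1 / 2) ^ i * blockSum b n ((k + l) / n) := hi ▸ h2 _ _ ((Nat.le_div_iff_mul_le hn).2 hk)
    _ ≤ (2 * lam ^ l) * (n * R ^ n * b (k + l)) := by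
      have := blockSum_nonneg hb n ((k + l) / n)
      exact mul_le_mul (pow_block_le h0 h1 hlam h3) (blockSum_le hb hR hf hg hn (k + l)) this
        (by positivity)
    _ = _ := by ring

/-- An increase propagates: `B (j+2) ≥ 4 B (j+1) - B j > 3 B (j+1)`. -/
theorem lt_succ_of_noncritical {B : ℕ → ℝ} (h0 : ∀ j, 0 ≤ B j)
    (hB : ∀ j, B (j + 1) ≤ 1 / 4 * (B j + B (j + 2))) {J : ℕ} (hJ : B J < B (J + 1)) (j : ℕ)
    (hj : J ≤ j) : B j < B (j + 1) := by
  induction j, hj using Nat.le_induction with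
  | base => exact hJ
  | succ j _ ih =>
    have h1 := hB j
    have h2 := h0 j
    have h3 : B (j + 1 + 1) = B (j + 2) := rfl
    linarith

theorem le_half_succ_of_noncritical {B : ℕ → ℝ} (h0 : ∀ j, 0 ≤ B j)
    (hB : ∀ j, B (j + 1) ≤ 1 / 4 * (B j + B (j + 2))) {J : ℕ} (hJ : B J < B (J + 1)) (j : ℕ)
    (hj : J + 1 ≤ j) : B j ≤ 1 / 2 * B (j + 1) := by
  obtain ⟨i, rfl⟩ := Nat.exists_eq_add_of_le' (le_trans (Nat.le_add_left 1 J) hj)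
  have h1 := lt_succ_of_noncritical h0 hB hJ i (by omega)
  have h2 := hB i
  have h3 := h0 (i + 1)
  have h4 : B (i + 1 + 1) = B (i + 2) := rfl
  linarith

/-- A single increase would force doubling forever after. -/
theorem succ_le_of_noncritical_of_bounded {B : ℕ → ℝ} (h0 : ∀ j, 0 ≤ B j)
    (hB : ∀ j, B (j + 1) ≤ 1 / 4 * (B j + B (j + 2))) {M : ℝ} (hM : ∀ j, B j ≤ M) (J : ℕ) :
    B (J + 1) ≤ B J := by
  by_contra! hJ
  have h1 : ∀ i, 2 ^ i * B (J + 1) ≤ B (J + 1 + i) := by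
    intro i
    induction i with
    | zero => simp
    | succ i ih =>
      have := le_half_succ_of_noncritical h0 hB hJ (J + 1 + i) (by omega)
      rw [pow_succ]
      have h3 : B (J + 1 + (i + 1)) = B (J + 1 + i + 1) := rfl
      linarith
  have hpos : 0 < B (J + 1) := (h0 J).trans_lt hJ
  obtain ⟨i, hi⟩ := pow_unbounded_of_one_lt (M / B (J + 1)) (one_lt_two (α := ℝ))
  rw [div_lt_iff₀ hpos] at hi
  exact absurd ((h1 i).trans (hM _)) (not_le.2 hi)

theorem exists_pow_eq_half {n : ℕ} (hn : 0 < n) :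
    ∃ lam : ℝ, 0 < lam ∧ lam < 1 ∧ lam ^ n = 1 / 2 := by
  refine ⟨(1 / 2 : ℝ) ^ (1 / (n : ℝ)), by positivity, ?_, ?_⟩
  · exact Real.rpow_lt_one (by norm_num) (by norm_num) (by positivity)
  · rw [one_div (n : ℝ)]
    exact Real.rpow_inv_natCast_pow (by norm_num) hn.ne'

end Scalar

/-! ### Dichotomies on a half-line and their duality. -/

section HalfLine

variable {V : Type*} [NormedAddCommGroup V] [InnerProductSpace ℝ V]
  {F : ℕ → Type*} [∀ n, NormedAddCommGroup (F n)] [∀ n, InnerProductSpace ℝ (F n)]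

/-- The trajectories `k ↦ X k x` decay exponentially for `x ∈ S` and grow exponentially for
`x ∈ U`. -/
def Dichotomy (X : ∀ n, V ≃L[ℝ] F n) (S U : Submodule ℝ V) : Prop :=
  ∃ C lam : ℝ, 0 < C ∧ 0 < lam ∧ lam < 1 ∧
    (∀ k l : ℕ, ∀ x ∈ S, ‖X (k + l) x‖ ≤ C * lam ^ l * ‖X k x‖) ∧
    (∀ k l : ℕ, ∀ x ∈ U, ‖X k x‖ ≤ C * lam ^ l * ‖X (k + l) x‖)

/-- The initial values of the bounded trajectories. -/
def boundedSubspace (X : ∀ n, V ≃L[ℝ] F n) : Submodule ℝ V where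
  carrier := {x | ∃ M : ℝ, ∀ k, ‖X k x‖ ≤ M}
  add_mem' := by
    rintro x y ⟨M, hM⟩ ⟨M', hM'⟩
    refine ⟨M + M', fun k => ?_⟩
    rw [map_add]
    exact (norm_add_le _ _).trans (add_le_add (hM k) (hM' k))
  zero_mem' := ⟨0, fun k => by simp⟩
  smul_mem' := by
    rintro c x ⟨M, hM⟩
    refine ⟨‖c‖ * M, fun k => ?_⟩
    rw [map_smul, norm_smul]
    exact mul_le_mul_of_nonneg_left (hM k) (norm_nonneg c)

/-- Compactness: the open sets of `x` whose block sums increase at step `J` grow with `J`, and they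
cover the unit sphere of `U`, because a trajectory whose block sums never increase is bounded. -/
theorem exists_uniform_growth_index [FiniteDimensional ℝ V] (X : ∀ n, V ≃L[ℝ] F n) {n : ℕ}
    (hn : 0 < n)
    (hw : ∀ x i, ∑ k ∈ Finset.Ioo i (i + 2 * n), ‖X k x‖ ≤
      n / 4 * (‖X i x‖ + ‖X (i + 2 * n) x‖))
    {U : Submodule ℝ V} (hU : Disjoint (boundedSubspace X) U) :
    ∃ J, ∀ x ∈ U, x ≠ 0 →
      blockSum (fun k => ‖X k x‖) n J < blockSum (fun k => ‖X k x‖) n (J + 1) := by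
  have hnc : ∀ x j, blockSum (fun k => ‖X k x‖) n (j + 1) ≤
      1 / 4 * (blockSum (fun k => ‖X k x‖) n j + blockSum (fun k => ‖X k x‖) n (j + 2)) :=
    fun x => blockSum_noncritical (fun k => norm_nonneg _) hn (hw x)
  have h0 : ∀ x j, 0 ≤ blockSum (fun k => ‖X k x‖) n j :=
    fun x => blockSum_nonneg (fun k => norm_nonneg _) n
  have hcont : ∀ j, Continuous fun x => blockSum (fun k => ‖X k x‖) n j := by
    intro j
    unfold blockSum
    fun_prop
  have hK : IsCompact (Metric.sphere (0 : V) 1 ∩ (U : Set V)) :=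
    (isCompact_sphere 0 1).inter_right U.closed_of_finiteDimensional
  obtain ⟨J, hJ⟩ := hK.elim_directed_cover
    (fun j => {x | blockSum (fun k => ‖X k x‖) n j < blockSum (fun k => ‖X k x‖) n (j + 1)})
    (fun j => isOpen_lt (hcont j) (hcont (j + 1))) (by
      rintro x ⟨hx1, hxU⟩
      rw [Set.mem_iUnion]
      by_contra! hx
      have hanti : Antitone (blockSum (fun k => ‖X k x‖) n) :=
        antitone_nat_of_succ_le fun j => not_lt.1 (hx j)
      have hxS : x ∈ boundedSubspace X :=
        ⟨_, fun k => (le_blockSum (b := fun k => ‖X k x‖) (fun k => norm_nonneg _) hn k).trans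
          (hanti (Nat.zero_le _))⟩
      have hx0 : x = 0 := (Submodule.disjoint_def.1 hU) x hxS hxU
      simp [hx0] at hx1)
    (directed_of_isDirected_le fun i j hij x hx =>
      lt_succ_of_noncritical (h0 x) (hnc x) hx j hij)
  refine ⟨J, fun x hx hx0 => ?_⟩
  have hpos : 0 < ‖x‖ := norm_pos_iff.2 hx0
  have h1 : (‖x‖⁻¹ • x) ∈ Metric.sphere (0 : V) 1 ∩ (U : Set V) := by
    refine ⟨?_, U.smul_mem _ hx⟩
    rw [mem_sphere_zero_iff_norm, norm_smul, norm_inv, norm_norm, inv_mul_cancel₀ hpos.ne']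
  have h2 := hJ h1
  have h3 : ∀ j, blockSum (fun k => ‖X k (‖x‖⁻¹ • x)‖) n j =
      ‖x‖⁻¹ * blockSum (fun k => ‖X k x‖) n j := by
    intro j
    simp only [blockSum, Finset.mul_sum, map_smul, norm_smul, norm_inv, norm_norm]
  rw [Set.mem_ofPred_eq, h3, h3] at h2
  exact lt_of_mul_lt_mul_left h2 (inv_nonneg.2 hpos.le)

/-- If every trajectory is noncritical on a fixed scale, then any complement of the space of
bounded trajectories gives a dichotomy. -/
theorem dichotomy_of_noncritical [FiniteDimensional ℝ V] (X : ∀ n, V ≃L[ℝ] F n) {R : ℝ}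
    (hR : 1 ≤ R) (hf : ∀ x k, ‖X (k + 1) x‖ ≤ R * ‖X k x‖)
    (hg : ∀ x k, ‖X k x‖ ≤ R * ‖X (k + 1) x‖) {n : ℕ} (hn : 0 < n)
    (hw : ∀ x i, ∑ k ∈ Finset.Ioo i (i + 2 * n), ‖X k x‖ ≤
      n / 4 * (‖X i x‖ + ‖X (i + 2 * n) x‖))
    {U : Submodule ℝ V} (hU : Disjoint (boundedSubspace X) U) :
    Dichotomy X (boundedSubspace X) U := by
  have hnc : ∀ x j, blockSum (fun k => ‖X k x‖) n (j + 1) ≤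
      1 / 4 * (blockSum (fun k => ‖X k x‖) n j + blockSum (fun k => ‖X k x‖) n (j + 2)) :=
    fun x => blockSum_noncritical (fun k => norm_nonneg _) hn (hw x)
  have h0 : ∀ x j, 0 ≤ blockSum (fun k => ‖X k x‖) n j :=
    fun x => blockSum_nonneg (fun k => norm_nonneg _) n
  have hnn : ∀ x k, 0 ≤ ‖X k x‖ := fun x k => norm_nonneg _
  obtain ⟨lam, hl0, hl1, hlam⟩ := exists_pow_eq_half hn
  obtain ⟨J, hJ⟩ := exists_uniform_growth_index X hn hw hU
  -- Growth is guaranteed only from time `m` on. For earlier times both ends are shifted by `m`, at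
  -- a cost of `R ^ m` each; the factor `(lam ^ m)⁻¹` in `D` is slack.
  set m := (J + 1) * n with hm
  have hn' : (0 : ℝ) < n := by exact_mod_cast hn
  have hR0 : 0 < R := by linarith
  set C := 2 * n * R ^ n with hC
  have hC0 : 0 < C := by positivity
  set D := (lam ^ m)⁻¹ * R ^ m * R ^ m with hD
  have hD1 : 1 ≤ D := by
    have h1 : 1 ≤ (lam ^ m)⁻¹ := (one_le_inv₀ (by positivity)).2 (pow_le_one₀ hl0.le hl1.le)
    have h2 : 1 ≤ R ^ m := one_le_pow₀ hR
    exact one_le_mul_of_one_le_of_one_le (one_le_mul_of_one_le_of_one_le h1 h2) h2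
  refine ⟨C * D, lam, by positivity, hl0, hl1, ?_, ?_⟩
  · rintro k l x ⟨M, hM⟩
    have hbd : ∀ j, blockSum (fun k => ‖X k x‖) n j ≤ n * M := by
      intro j
      rw [blockSum_eq_sum_range]
      refine (Finset.sum_le_sum fun r _ => hM _).trans_eq ?_
      simp
    have hdec := succ_le_of_noncritical_of_bounded (h0 x) (hnc x) hbd
    have h1 := decay_of_blockSum (hnn x) hR (hf x) (hg x) hn hl0 hl1 hlam (fun j => by
      have h2 := hnc x j
      have h3 := hdec (j + 1)
      have h4 := h0 x j
      have h5 := h0 x (j + 1)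
      have h6 : blockSum (fun k => ‖X k x‖) n (j + 1 + 1) =
        blockSum (fun k => ‖X k x‖) n (j + 2) := rfl
      linarith) k l
    refine h1.trans ?_
    rw [← hC]
    gcongr
    exact le_mul_of_one_le_right hC0.le hD1
  · intro k l x hx
    rcases eq_or_ne x 0 with rfl | hx0
    · simp
    have hinc : ∀ k l, m ≤ k → ‖X k x‖ ≤ C * lam ^ l * ‖X (k + l) x‖ := fun k l hk =>
      growth_of_blockSum (hnn x) hR (hf x) (hg x) hn hl0 hl1 hlam
        (le_half_succ_of_noncritical (h0 x) (hnc x) (hJ x hx hx0)) k l hk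
    have h1 : ‖X k x‖ ≤ R ^ m * ‖X (k + m) x‖ :=
      le_pow_mul_backward (b := fun k => ‖X k x‖) hR (hg x) k m
    have h2 : ‖X (k + m) x‖ ≤ C * lam ^ l * ‖X (k + m + l) x‖ := hinc _ _ (by omega)
    have h3 : ‖X (k + l + m) x‖ ≤ R ^ m * ‖X (k + l) x‖ :=
      le_pow_mul_forward (b := fun k => ‖X k x‖) hR (hf x) (k + l) m
    have h4 : ‖X (k + m + l) x‖ = ‖X (k + l + m) x‖ := by
      rw [show k + m + l = k + l + m by omega]
    have h5 : 1 ≤ (lam ^ m)⁻¹ := (one_le_inv₀ (by positivity)).2 (pow_le_one₀ hl0.le hl1.le)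
    calc ‖X k x‖ ≤ R ^ m * (C * lam ^ l * (R ^ m * ‖X (k + l) x‖)) := by
          refine h1.trans ?_
          gcongr
          refine h2.trans ?_
          rw [h4]
          gcongr
      _ = 1 * (C * (R ^ m * R ^ m) * lam ^ l * ‖X (k + l) x‖) := by ring
      _ ≤ (lam ^ m)⁻¹ * (C * (R ^ m * R ^ m) * lam ^ l * ‖X (k + l) x‖) := by gcongr
      _ = C * D * lam ^ l * ‖X (k + l) x‖ := by rw [hD]; ring

/-- The angle between the two subspaces stays away from zero: over `l` steps with `C * lam ^ l ≤ 1 /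
2` the part `s` is halved and `u` doubled, so near cancellation in `s + u` would make it grow by
more than `R ^ l`. -/
theorem Dichotomy.exists_projection_bound {X : ∀ n, V ≃L[ℝ] F n} {S U : Submodule ℝ V}
    (h : Dichotomy X S U) {R : ℝ} (hR : 1 ≤ R) (hf : ∀ x k, ‖X (k + 1) x‖ ≤ R * ‖X k x‖) :
    ∃ K : ℝ, 0 < K ∧ ∀ k, ∀ s ∈ S, ∀ u ∈ U,
      ‖X k s‖ ≤ K * ‖X k (s + u)‖ ∧ ‖X k u‖ ≤ K * ‖X k (s + u)‖ := by
  obtain ⟨C, lam, hC, h0, h1, hS, hU⟩ := h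
  obtain ⟨l, hl⟩ := exists_pow_lt_of_lt_one (show 0 < 1 / (2 * C) by positivity) h1
  have hl2 : C * lam ^ l ≤ 1 / 2 := by
    rw [lt_div_iff₀ (by positivity)] at hl
    linarith
  refine ⟨R ^ l + 2, by positivity, fun k s hs u hu => ?_⟩
  have a1 : ‖X (k + l) s‖ ≤ 1 / 2 * ‖X k s‖ :=
    (hS k l s hs).trans (mul_le_mul_of_nonneg_right hl2 (norm_nonneg _))
  have a2 : ‖X k u‖ ≤ 1 / 2 * ‖X (k + l) u‖ :=
    (hU k l u hu).trans (mul_le_mul_of_nonneg_right hl2 (norm_nonneg _))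
  have a3 : ‖X (k + l) (s + u)‖ ≤ R ^ l * ‖X k (s + u)‖ :=
    le_pow_mul_forward (b := fun k => ‖X k (s + u)‖) hR (hf (s + u)) k l
  have a4 : ‖X (k + l) u‖ ≤ ‖X (k + l) (s + u)‖ + ‖X (k + l) s‖ := by
    rw [map_add, add_comm]
    exact norm_le_add_norm_add' _ _
  have a5 : ‖X k s‖ ≤ ‖X k (s + u)‖ + ‖X k u‖ := by
    rw [map_add]
    exact norm_le_add_norm_add _ _
  have a6 := norm_nonneg (X k (s + u))
  have a7 : 0 ≤ R ^ l * ‖X k (s + u)‖ := by positivity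
  constructor <;> nlinarith

/-- Orthogonal complements carry the dichotomy of the adjoint system over to the system. -/
theorem Dichotomy.orthogonal {X Y : ∀ n, V ≃L[ℝ] F n} {S U : Submodule ℝ V}
    (hXY : ∀ k x y, inner ℝ (Y k y) (X k x) = inner ℝ y x)
    (hc : S ⊔ U = ⊤) (h : Dichotomy Y S U) {R : ℝ} (hR : 1 ≤ R)
    (hf : ∀ x k, ‖Y (k + 1) x‖ ≤ R * ‖Y k x‖) : Dichotomy X Sᗮ Uᗮ := by
  obtain ⟨K, hK, hb⟩ := h.exists_projection_bound hR hf
  obtain ⟨C, lam, hC, h0, h1, hS, hU⟩ := h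
  have hsq : ∀ a c : ℝ, 0 ≤ a → 0 ≤ c → a * a ≤ c * a → a ≤ c := by
    intro a c ha hc h
    rcases ha.eq_or_lt with rfl | ha
    · exact hc
    · exact le_of_mul_le_mul_right h ha
  refine ⟨C * K, lam, by positivity, h0, h1, ?_, ?_⟩
  · intro k l x hx
    refine hsq _ _ (norm_nonneg _) (by positivity) ?_
    -- Write the vector `X (k + l) x` as an adjoint value `Y (k + l) (s + u)`. Its squared norm is a
    -- pairing, hence computable at time `k`, where `s` drops out and `u` is small.
    obtain ⟨s, hs, u, hu, hsu⟩ := Submodule.mem_sup.1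
      (hc ▸ Submodule.mem_top : (Y (k + l)).symm (X (k + l) x) ∈ S ⊔ U)
    have e : Y (k + l) (s + u) = X (k + l) x := by simp [hsu]
    calc ‖X (k + l) x‖ * ‖X (k + l) x‖ = inner ℝ (X (k + l) x) (X (k + l) x) :=
          (real_inner_self_eq_norm_mul_norm _).symm
      _ = inner ℝ (s + u) x := by rw [← hXY (k + l), e]
      _ = inner ℝ u x := by
          rw [inner_add_left, (Submodule.mem_orthogonal S x).1 hx s hs, zero_add]
      _ = inner ℝ (Y k u) (X k x) := (hXY k x u).symm
      _ ≤ ‖Y k u‖ * ‖X k x‖ := real_inner_le_norm _ _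
      _ ≤ (C * lam ^ l * (K * ‖X (k + l) x‖)) * ‖X k x‖ := by
          gcongr
          refine (hU k l u hu).trans ?_
          gcongr
          exact e ▸ (hb (k + l) s hs u hu).2
      _ = _ := by ring
  · intro k l x hx
    refine hsq _ _ (norm_nonneg _) (by positivity) ?_
    obtain ⟨s, hs, u, hu, hsu⟩ := Submodule.mem_sup.1
      (hc ▸ Submodule.mem_top : (Y k).symm (X k x) ∈ S ⊔ U)
    have e : Y k (s + u) = X k x := by simp [hsu]
    calc ‖X k x‖ * ‖X k x‖ = inner ℝ (X k x) (X k x) :=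
          (real_inner_self_eq_norm_mul_norm _).symm
      _ = inner ℝ (s + u) x := by rw [← hXY k, e]
      _ = inner ℝ s x := by
          rw [inner_add_left, (Submodule.mem_orthogonal U x).1 hx u hu, add_zero]
      _ = inner ℝ (Y (k + l) s) (X (k + l) x) := (hXY (k + l) x s).symm
      _ ≤ ‖Y (k + l) s‖ * ‖X (k + l) x‖ := real_inner_le_norm _ _
      _ ≤ (C * lam ^ l * (K * ‖X k x‖)) * ‖X (k + l) x‖ := by
          gcongr
          refine (hS k l s hs).trans ?_
          gcongr
          exact e ▸ (hb k s hs u hu).1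
      _ = _ := by ring

theorem isCompl_orthogonal [FiniteDimensional ℝ V] {S U : Submodule ℝ V} (h : IsCompl S U) :
    IsCompl Sᗮ Uᗮ := by
  rw [isCompl_iff, disjoint_iff, codisjoint_iff]
  refine ⟨?_, ?_⟩
  · rw [Submodule.inf_orthogonal, h.sup_eq_top, Submodule.top_orthogonal_eq_bot]
  · have h1 : (Sᗮ ⊔ Uᗮ)ᗮ = ⊥ := by
      rw [← Submodule.inf_orthogonal, Submodule.orthogonal_orthogonal,
        Submodule.orthogonal_orthogonal, h.inf_eq_bot]
    rwa [Submodule.orthogonal_eq_bot_iff] at h1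

/-- If the adjoint system is noncritical, then any complement of the orthogonal complement of its
space of bounded trajectories gives a dichotomy of the system. -/
theorem dichotomy_of_adjoint_noncritical [FiniteDimensional ℝ V] {X Y : ∀ n, V ≃L[ℝ] F n}
    (hXY : ∀ k x y, inner ℝ (Y k y) (X k x) = inner ℝ y x) {R : ℝ} (hR : 1 ≤ R)
    (hf : ∀ x k, ‖Y (k + 1) x‖ ≤ R * ‖Y k x‖) (hg : ∀ x k, ‖Y k x‖ ≤ R * ‖Y (k + 1) x‖)
    {n : ℕ} (hn : 0 < n)
    (hw : ∀ x i, ∑ k ∈ Finset.Ioo i (i + 2 * n), ‖Y k x‖ ≤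
      n / 4 * (‖Y i x‖ + ‖Y (i + 2 * n) x‖))
    {W : Submodule ℝ V} (hW : IsCompl (boundedSubspace Y)ᗮ W) :
    Dichotomy X (boundedSubspace Y)ᗮ W := by
  have h1 : IsCompl (boundedSubspace Y) Wᗮ := by
    have := isCompl_orthogonal hW
    rwa [Submodule.orthogonal_orthogonal] at this
  have h2 := (dichotomy_of_noncritical Y hR hf hg hn hw h1.disjoint).orthogonal hXY
    h1.sup_eq_top hR hf
  rwa [Submodule.orthogonal_orthogonal] at h2

end HalfLine

/-! ### Gluing two half-line dichotomies at time `0`. -/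

section Splitting

variable {V : Type*} [NormedAddCommGroup V] [InnerProductSpace ℝ V]

/-- A complement of `S` inside `U` makes the component off `S` decay along both half-lines: towards
`0` on one, and, being in `U`, away from `0` on the other. -/
theorem exists_le_isCompl_of_sup_eq_top {S U : Submodule ℝ V} (h : S ⊔ U = ⊤) :
    ∃ W ≤ U, IsCompl S W := by
  obtain ⟨W, hd, hW⟩ := IsModularLattice.exists_disjoint_and_sup_eq (inf_le_right : S ⊓ U ≤ U)
  have hWU : W ≤ U := le_sup_right.trans_eq hW
  refine ⟨W, hWU, ?_, ?_⟩
  · rw [disjoint_iff] at hd ⊢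
    rw [← hd, inf_assoc, inf_eq_right.2 hWU]
  · rw [codisjoint_iff, eq_top_iff, ← h, ← hW, ← sup_assoc, sup_inf_self]

/-- Two half-line systems with the same initial norm: a vector at time `j` on the first half-line
splits into a part decaying away from the second half-line, and a part decaying towards and along
the second half-line. -/
theorem exists_splitting_halfLine {F G : ℕ → Type*} [∀ n, NormedAddCommGroup (F n)]
    [∀ n, InnerProductSpace ℝ (F n)] [∀ n, NormedAddCommGroup (G n)]
    [∀ n, InnerProductSpace ℝ (G n)] {X : ∀ n, V ≃L[ℝ] F n} {Z : ∀ n, V ≃L[ℝ] G n}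
    (h0 : ∀ x, ‖Z 0 x‖ = ‖X 0 x‖) {R : ℝ} (hR : 1 ≤ R)
    (hf : ∀ x k, ‖X (k + 1) x‖ ≤ R * ‖X k x‖) {S W U T : Submodule ℝ V} (hSW : S ⊔ W = ⊤)
    (hWU : W ≤ U) (hX : Dichotomy X S W) (hZ : Dichotomy Z U T) :
    ∃ C lam : ℝ, 0 < C ∧ 0 < lam ∧ lam < 1 ∧ ∀ (j : ℕ) (z : V), ∃ s u : V, s + u = z ∧
      (∀ l, ‖X (j + l) s‖ ≤ C * lam ^ l * ‖X j z‖) ∧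
      (∀ i l, i + l = j → ‖X i u‖ ≤ C * lam ^ l * ‖X j z‖) ∧
      (∀ l, ‖Z l u‖ ≤ C * lam ^ (j + l) * ‖X j z‖) := by
  obtain ⟨K, hK, hb⟩ := hX.exists_projection_bound hR hf
  obtain ⟨C, lam, hC, hl0, hl1, hS, hW⟩ := hX
  obtain ⟨C', lam', hC', hl0', hl1', hU, -⟩ := hZ
  set mu := max lam lam' with hmu
  have hm0 : 0 < mu := lt_max_of_lt_left hl0
  have key : ∀ l x, C * mu ^ l * (K * x) = C * K * mu ^ l * x := fun l x => by ring
  refine ⟨(C' + 1) * (C * K), mu, by positivity, hm0, max_lt hl1 hl1', fun j z => ?_⟩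
  have hCC : C * K ≤ (C' + 1) * (C * K) := le_mul_of_one_le_left (by positivity) (by linarith)
  obtain ⟨s, hs, u, hu, hsu⟩ := Submodule.mem_sup.1 (hSW ▸ Submodule.mem_top : z ∈ S ⊔ W)
  have hbs := (hb j s hs u hu).1
  have hbu := (hb j s hs u hu).2
  rw [hsu] at hbs hbu
  have hback : ∀ i l, i + l = j → ‖X i u‖ ≤ C * K * mu ^ l * ‖X j z‖ := by
    rintro i l rfl
    refine (hW i l u hu).trans ?_
    rw [← key]
    gcongr
    exact le_max_left _ _
  refine ⟨s, u, hsu, fun l => ?_, fun i l hil => ?_, fun l => ?_⟩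
  · refine (hS j l s hs).trans ?_
    calc C * lam ^ l * ‖X j s‖ ≤ C * mu ^ l * (K * ‖X j z‖) := by
          gcongr
          exact le_max_left _ _
      _ = C * K * mu ^ l * ‖X j z‖ := key _ _
      _ ≤ _ := by gcongr
  · refine (hback i l hil).trans ?_
    gcongr
  -- The trajectory passes through time `0`: `j` steps of decay on the first half-line, then `l`
  -- more on the second.
  · have h1 := hU 0 l u (hWU hu)
    rw [zero_add, h0] at h1
    calc ‖Z l u‖ ≤ C' * lam' ^ l * ‖X 0 u‖ := h1
      _ ≤ C' * mu ^ l * (C * K * mu ^ j * ‖X j z‖) := by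
          gcongr
          · exact le_max_right _ _
          · exact hback 0 j (zero_add j)
      _ = C' * (C * K) * mu ^ (j + l) * ‖X j z‖ := by ring
      _ ≤ _ := by
          gcongr
          linarith

end Splitting

/-! ### The whole line: bounded solutions from a splitting, and the adjoint estimate. -/

section Line

variable {V : Type*} [NormedAddCommGroup V] [InnerProductSpace ℝ V]
  {E : ℤ → Type*} [∀ n, NormedAddCommGroup (E n)] [∀ n, InnerProductSpace ℝ (E n)]

theorem norm_apply_congr (X : ∀ n, V ≃L[ℝ] E n) {a b : ℤ} (h : a = b) (x : V) :
    ‖X a x‖ = ‖X b x‖ := by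
  subst h; rfl

/-- The two half-line dichotomies, in general position, split every vector at every time. -/
theorem exists_splitting {X : ∀ n, V ≃L[ℝ] E n} {R : ℝ} (hR : 1 ≤ R)
    (hf : ∀ x k, ‖X (k + 1) x‖ ≤ R * ‖X k x‖) (hg : ∀ x k, ‖X k x‖ ≤ R * ‖X (k + 1) x‖)
    {S U : Submodule ℝ V} (hSU : S ⊔ U = ⊤)
    (hp : ∀ W, IsCompl S W → Dichotomy (fun n : ℕ => X n) S W)
    (hm : ∀ W, IsCompl U W → Dichotomy (fun n : ℕ => X (-(n : ℤ))) U W) :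
    ∃ C lam : ℝ, 0 < C ∧ 0 < lam ∧ lam < 1 ∧ ∀ (j : ℤ) (z : V), ∃ s u : V, s + u = z ∧
      (∀ k, j ≤ k → ‖X k s‖ ≤ C * lam ^ (k - j).toNat * ‖X j z‖) ∧
      (∀ k, k ≤ j → ‖X k u‖ ≤ C * lam ^ (j - k).toNat * ‖X j z‖) := by
  obtain ⟨W, hWU, hW⟩ := exists_le_isCompl_of_sup_eq_top hSU
  obtain ⟨T, hTS, hT⟩ := exists_le_isCompl_of_sup_eq_top (sup_comm U S ▸ hSU : U ⊔ S = ⊤)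
  obtain ⟨C, lam, hC, hl0, hl1, h1⟩ := exists_splitting_halfLine (X := fun n : ℕ => X n)
    (Z := fun n : ℕ => X (-(n : ℤ))) (fun x => norm_apply_congr X (by simp) x) hR
    (fun x k => (norm_apply_congr X (by push_cast; rfl) x).trans_le (hf x k))
    hW.sup_eq_top hWU (hp W hW) (hm T hT)
  -- The same under time reversal, for `j ≤ 0`; the roles of `s` and `u` are exchanged.
  obtain ⟨C', lam', hC', hl0', hl1', h2⟩ := exists_splitting_halfLine
    (X := fun n : ℕ => X (-(n : ℤ))) (Z := fun n : ℕ => X n)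
    (fun x => norm_apply_congr X (by simp) x) hR
    (fun x k => (hg x _).trans_eq (by
      rw [norm_apply_congr X (show -((k + 1 : ℕ) : ℤ) + 1 = -(k : ℤ) by push_cast; ring)]))
    hT.sup_eq_top hTS (hm T hT) (hp W hW)
  set mu := max lam lam' with hmu
  set D := max C C' with hD
  have hm0 : 0 < mu := lt_max_of_lt_left hl0
  have hD0 : 0 < D := lt_max_of_lt_left hC
  have e1 : ∀ (l : ℕ) (x : V) (j : ℤ), C * lam ^ l * ‖X j x‖ ≤ D * mu ^ l * ‖X j x‖ := by
    intro l x j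
    gcongr
    · exact le_max_left _ _
    · exact le_max_left _ _
  have e2 : ∀ (l : ℕ) (x : V) (j : ℤ), C' * lam' ^ l * ‖X j x‖ ≤ D * mu ^ l * ‖X j x‖ := by
    intro l x j
    gcongr
    · exact le_max_right _ _
    · exact le_max_right _ _
  refine ⟨D, mu, hD0, hm0, max_lt hl1 hl1', fun j z => ?_⟩
  rcases le_total 0 j with hj | hj
  · obtain ⟨j, rfl⟩ := Int.eq_ofNat_of_zero_le hj
    obtain ⟨s, u, hsu, ha, hb, hc⟩ := h1 j z
    refine ⟨s, u, hsu, fun k hk => ?_, fun k hk => ?_⟩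
    · obtain ⟨l, rfl⟩ := Int.le.dest hk
      have h3 := (ha l).trans (e1 l z j)
      rw [show ((j : ℤ) + l - j).toNat = l by omega]
      exact (norm_apply_congr X (by push_cast; rfl) s).trans_le h3
    · rcases le_total 0 k with hk0 | hk0
      · obtain ⟨i, rfl⟩ := Int.eq_ofNat_of_zero_le hk0
        exact (hb i ((j : ℤ) - i).toNat (by omega)).trans (e1 _ z j)
      · obtain ⟨l, rfl⟩ := Int.exists_eq_neg_ofNat hk0
        rw [show ((j : ℤ) - -l).toNat = j + l by omega]
        exact (hc l).trans (e1 _ z j)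
  · obtain ⟨j, rfl⟩ := Int.exists_eq_neg_ofNat hj
    obtain ⟨u, s, hsu, ha, hb, hc⟩ := h2 j z
    refine ⟨s, u, by rw [add_comm, hsu], fun k hk => ?_, fun k hk => ?_⟩
    · rcases le_total 0 k with hk0 | hk0
      · obtain ⟨l, rfl⟩ := Int.eq_ofNat_of_zero_le hk0
        rw [show ((l : ℤ) - -j).toNat = j + l by omega]
        exact (hc l).trans (e2 _ z _)
      · obtain ⟨i, rfl⟩ := Int.exists_eq_neg_ofNat hk0
        exact (hb i (-(i : ℤ) - -j).toNat (by omega)).trans (e2 _ z _)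
    · obtain ⟨l, hl⟩ := Int.le.dest hk
      have h3 := (ha l).trans (e2 l z _)
      rw [show (-(j : ℤ) - k).toNat = l by omega]
      exact (norm_apply_congr X (by push_cast; omega) u).trans_le h3

theorem sum_pow_le {lam : ℝ} (h0 : 0 < lam) (h1 : lam < 1) (s : Finset ℤ) (g : ℤ → ℕ)
    (hg : Set.InjOn g s) : ∑ j ∈ s, lam ^ g j ≤ (1 - lam)⁻¹ := by
  rw [← Finset.sum_image (g := g) (f := fun l : ℕ => lam ^ l) hg,
    ← tsum_geometric_of_lt_one h0.le h1]
  exact (summable_geometric_of_lt_one h0.le h1).sum_le_tsum _ (fun i _ => by positivity)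

/-- Green's function: the impulse `w j` acts forward through `s j` and, with a minus sign, backward
through `u j`. From `k` to `k + 1` the index `k + 1` changes sums, which adds `s (k+1) + u (k+1)`,
that is `w (k+1)`. Two geometric series bound the result. -/
theorem boundedSolution_of_splitting {A : ∀ n : ℤ, E n ≃L[ℝ] E (n + 1)} {X : ∀ n, V ≃L[ℝ] E n}
    (hX : ∀ n x, X (n + 1) x = A n (X n x))
    (h : ∃ C lam : ℝ, 0 < C ∧ 0 < lam ∧ lam < 1 ∧ ∀ (j : ℤ) (z : V), ∃ s u : V, s + u = z ∧
      (∀ k, j ≤ k → ‖X k s‖ ≤ C * lam ^ (k - j).toNat * ‖X j z‖) ∧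
      (∀ k, k ≤ j → ‖X k u‖ ≤ C * lam ^ (j - k).toNat * ‖X j z‖)) :
    BoundedSolution A := by
  obtain ⟨C, lam, hC, h0, h1, h⟩ := h
  have h1' : 0 < 1 - lam := by linarith
  refine ⟨C * (1 - lam)⁻¹ + C * (1 - lam)⁻¹, by positivity, fun i N _ w hw => ?_⟩
  choose s u hsu hs hu using fun j => h j ((X j).symm (w j))
  have hw1 : ∀ j, ‖X j ((X j).symm (w j))‖ = ‖w j‖ := fun j => by simp
  refine ⟨fun k => X k (∑ j ∈ Finset.Icc (i + 1) k, s j - ∑ j ∈ Finset.Icc (k + 1) (i + N), u j),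
    fun k hk => ?_, fun k hk => ?_⟩
  · rw [Set.mem_Icc] at hk
    have a1 : ∑ j ∈ Finset.Icc (i + 1) (k + 1), s j =
        s (k + 1) + ∑ j ∈ Finset.Icc (i + 1) k, s j := by
      rw [← Finset.sum_insert (by simp)]
      congr 1
      ext j
      simp only [Finset.mem_Icc, Finset.mem_insert]
      omega
    have a2 : ∑ j ∈ Finset.Icc (k + 1) (i + N), u j =
        u (k + 1) + ∑ j ∈ Finset.Icc (k + 1 + 1) (i + N), u j := by
      rw [← Finset.sum_insert (by simp)]
      congr 1
      ext j
      simp only [Finset.mem_Icc, Finset.mem_insert]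
      omega
    have a3 : w (k + 1) = X (k + 1) (s (k + 1) + u (k + 1)) := by simp [hsu]
    rw [← hX, a3, ← map_add]
    beta_reduce
    rw [a1, a2]
    congr 1
    abel
  · rw [Set.mem_Icc] at hk
    beta_reduce
    rw [Real.rpow_zero, mul_one, map_sub, map_sum, map_sum]
    refine (norm_sub_le _ _).trans (add_le_add ?_ ?_)
    · calc ‖∑ j ∈ Finset.Icc (i + 1) k, X k (s j)‖
          ≤ ∑ j ∈ Finset.Icc (i + 1) k, ‖X k (s j)‖ := norm_sum_le _ _
        _ ≤ ∑ j ∈ Finset.Icc (i + 1) k, C * lam ^ (k - j).toNat := by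
          refine Finset.sum_le_sum fun j hj => ?_
          rw [Finset.mem_Icc] at hj
          refine (hs j k hj.2).trans (mul_le_of_le_one_right (by positivity) ?_)
          rw [hw1]
          exact hw j ⟨hj.1, by omega⟩
        _ ≤ C * (1 - lam)⁻¹ := by
          rw [← Finset.mul_sum]
          gcongr
          refine sum_pow_le h0 h1 _ (fun j => (k - j).toNat) ?_
          intro a ha b hb hab
          simp only [Finset.coe_Icc, Set.mem_Icc] at ha hb hab
          omega
    · calc ‖∑ j ∈ Finset.Icc (k + 1) (i + N), X k (u j)‖
          ≤ ∑ j ∈ Finset.Icc (k + 1) (i + N), ‖X k (u j)‖ := norm_sum_le _ _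
        _ ≤ ∑ j ∈ Finset.Icc (k + 1) (i + N), C * lam ^ (j - k).toNat := by
          refine Finset.sum_le_sum fun j hj => ?_
          rw [Finset.mem_Icc] at hj
          refine (hu j k (by omega)).trans (mul_le_of_le_one_right (by positivity) ?_)
          rw [hw1]
          exact hw j ⟨by omega, hj.2⟩
        _ ≤ C * (1 - lam)⁻¹ := by
          rw [← Finset.mul_sum]
          gcongr
          refine sum_pow_le h0 h1 _ (fun j => (j - k).toNat) ?_
          intro a ha b hb hab
          simp only [Finset.coe_Icc, Set.mem_Icc] at ha hb hab
          omega

/-- Slow growth makes the trajectories of the adjoint system noncritical. -/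
theorem SlowGrowth.exists_sum_le {A : ∀ n : ℤ, E n ≃L[ℝ] E (n + 1)} {γ : ℝ} (h : SlowGrowth A γ)
    {X Y : ∀ n, V ≃L[ℝ] E n} (hX : ∀ n x, X (n + 1) x = A n (X n x))
    (hXY : ∀ k x y, inner ℝ (Y k y) (X k x) = inner ℝ y x) :
    ∃ L : ℝ, 0 < L ∧ ∀ (x : V) (i : ℤ) (N : ℕ), 0 < N →
      ∑ k ∈ Finset.Ioo i (i + N), ‖Y k x‖ ≤ L * (N : ℝ) ^ γ * (‖Y i x‖ + ‖Y (i + N) x‖) := by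
  obtain ⟨L, hL, h⟩ := h
  refine ⟨L, hL, fun x i N hN => ?_⟩
  -- Unit vectors along the adjoint trajectory; if `Y k x = 0`, the convention `0⁻¹ = 0` gives the
  -- zero vector.
  obtain ⟨v, hv, hb⟩ := h i N hN (fun k => ‖Y k x‖⁻¹ • Y k x) (fun k _ => by
    rw [norm_smul, norm_inv, norm_norm]
    exact inv_mul_le_one)
  set f : ℤ → ℝ := fun k => inner ℝ (Y k x) (v k) with hf
  have hstep : ∀ k ∈ Set.Icc i (i + N - 1), ‖Y (k + 1) x‖ = f (k + 1) - f k := by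
    intro k hk
    have e1 : A k (v k) = X (k + 1) ((X k).symm (v k)) := by simp [hX]
    have e2 : inner ℝ (Y (k + 1) x) (A k (v k)) = f k := by
      rw [e1, hXY, ← hXY k]
      simp [hf]
    have e3 : inner ℝ (Y (k + 1) x) (‖Y (k + 1) x‖⁻¹ • Y (k + 1) x) = ‖Y (k + 1) x‖ := by
      rw [real_inner_smul_right, real_inner_self_eq_norm_mul_norm]
      rcases eq_or_ne ‖Y (k + 1) x‖ 0 with h | h
      · simp [h]
      · field_simp
    have e4 : f (k + 1) = f k + ‖Y (k + 1) x‖ := by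
      simp only [hf] at e2 ⊢
      rw [hv k hk, inner_add_right, e2, e3]
    linarith
  have hsub : Finset.Ioo i (i + N) ⊆ (Finset.range N).image (fun t : ℕ => i + t + 1) := by
    intro k hk
    rw [Finset.mem_Ioo] at hk
    rw [Finset.mem_image]
    exact ⟨(k - i - 1).toNat, by rw [Finset.mem_range]; omega, by omega⟩
  have hfi : |f i| ≤ ‖Y i x‖ * (L * (N : ℝ) ^ γ) := by
    refine (abs_real_inner_le_norm _ _).trans ?_
    gcongr
    exact hb i ⟨le_rfl, by omega⟩
  have hfN : |f (i + N)| ≤ ‖Y (i + N) x‖ * (L * (N : ℝ) ^ γ) := by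
    refine (abs_real_inner_le_norm _ _).trans ?_
    gcongr
    exact hb (i + N) ⟨by omega, le_rfl⟩
  calc ∑ k ∈ Finset.Ioo i (i + N), ‖Y k x‖
      ≤ ∑ k ∈ (Finset.range N).image (fun t : ℕ => i + t + 1), ‖Y k x‖ :=
        Finset.sum_le_sum_of_subset_of_nonneg hsub (fun _ _ _ => norm_nonneg _)
    _ = ∑ t ∈ Finset.range N, ‖Y (i + t + 1) x‖ := by
        rw [Finset.sum_image]
        intro a _ b _ hab
        simpa using hab
    _ = ∑ t ∈ Finset.range N, (f (i + (t + 1 : ℕ)) - f (i + t)) := by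
        refine Finset.sum_congr rfl fun t ht => ?_
        rw [Finset.mem_range] at ht
        rw [hstep (i + t) ⟨by omega, by omega⟩]
        push_cast
        rw [add_assoc]
    _ = f (i + N) - f i := by
        rw [Finset.sum_range_sub (fun t : ℕ => f (i + t))]
        simp
    _ ≤ _ := by
        have a1 := neg_abs_le (f i)
        have a2 := le_abs_self (f (i + N))
        linarith

/-- The place where sublinearity enters: `(2n) ^ (1 - γ) ≥ 8 L` for large `n`. -/
theorem exists_scale {γ : ℝ} (hγ : γ < 1) (L : ℝ) :
    ∃ n₀ : ℕ, 0 < n₀ ∧ ∀ n : ℕ, n₀ ≤ n → L * ((2 * n : ℕ) : ℝ) ^ γ ≤ n / 4 := by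
  have h1 : Filter.Tendsto (fun n : ℕ => ((2 * n : ℕ) : ℝ) ^ (1 - γ)) Filter.atTop Filter.atTop :=
    (tendsto_rpow_atTop (by linarith)).comp (tendsto_natCast_atTop_atTop.comp
      (Filter.tendsto_id.const_mul_atTop' (by norm_num)))
  obtain ⟨n₀, hn₀⟩ := Filter.eventually_atTop.1 (h1.eventually_ge_atTop (8 * L))
  refine ⟨n₀ + 1, by omega, fun n hn => ?_⟩
  have h2 := hn₀ n (by omega)
  have hpos : (0 : ℝ) < ((2 * n : ℕ) : ℝ) := by exact_mod_cast (by omega : 0 < 2 * n)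
  have h3 : ((2 * n : ℕ) : ℝ) ^ (1 - γ) * ((2 * n : ℕ) : ℝ) ^ γ = ((2 * n : ℕ) : ℝ) := by
    rw [← Real.rpow_add hpos, sub_add_cancel, Real.rpow_one]
  have h4 : 8 * L * ((2 * n : ℕ) : ℝ) ^ γ ≤ ((2 * n : ℕ) : ℝ) :=
    (mul_le_mul_of_nonneg_right h2 (by positivity)).trans_eq h3
  have h5 : ((2 * n : ℕ) : ℝ) = 2 * n := by push_cast; ring
  rw [h5] at h4 ⊢
  linarith

theorem exists_mul_pow_lt_one (C : ℝ) {lam : ℝ} (h0 : 0 < lam) (h1 : lam < 1) (n₀ : ℕ) :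
    ∃ n : ℕ, n₀ ≤ n ∧ n * (C * lam ^ n) < 1 := by
  have h2 := (tendsto_self_mul_const_pow_of_lt_one h0.le h1).const_mul C
  rw [mul_zero] at h2
  obtain ⟨n, hn, hn'⟩ :=
    ((h2.eventually_lt_const one_pos).and (Filter.eventually_ge_atTop n₀)).exists
  exact ⟨n, hn', by linarith⟩

end Line

/-! ### Fundamental solution and adjoint system. -/

section Trivialization

theorem exists_int_product {G : Type*} [Group G] (B : ℤ → G) :
    ∃ T : ℤ → G, ∀ n, T (n + 1) = B n * T n := by
  let T : ℤ → G := fun n => match n with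
    | Int.ofNat n => Nat.rec 1 (fun k t => B k * t) n
    | Int.negSucc n => Nat.rec (B (-1))⁻¹ (fun k t => (B (Int.negSucc (k + 1)))⁻¹ * t) n
  refine ⟨T, fun n => ?_⟩
  rcases n with n | n
  · rfl
  · rcases n with _ | n
    · exact (mul_inv_cancel (B (-1))).symm
    · exact (mul_inv_cancel_left (B (Int.negSucc (n + 1))) (T (Int.negSucc n))).symm

variable {E : ℤ → Type*} [∀ n, NormedAddCommGroup (E n)] [∀ n, InnerProductSpace ℝ (E n)]

/-- Equal dimensions identify all fibres with one space, where the equation becomes a recursion in a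
group. The identifications need not be isometric: later estimates compare only norms in the fibres.
-/
theorem exists_fundamental_solution [∀ n, FiniteDimensional ℝ (E n)] {m : ℕ}
    (hm : ∀ n, Module.finrank ℝ (E n) = m) (A : ∀ n : ℤ, E n ≃L[ℝ] E (n + 1)) :
    ∃ X : ∀ n, EuclideanSpace ℝ (Fin m) ≃L[ℝ] E n, ∀ n x, X (n + 1) x = A n (X n x) := by
  let e : ∀ n, EuclideanSpace ℝ (Fin m) ≃L[ℝ] E n := fun n =>
    ContinuousLinearEquiv.ofFinrankEq (by rw [finrank_euclideanSpace_fin, hm])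
  obtain ⟨T, hT⟩ := exists_int_product fun n =>
    ((e n).trans (A n)).trans (e (n + 1)).symm
  refine ⟨fun n => (T n).trans (e n), fun n x => ?_⟩
  change e (n + 1) (T (n + 1) x) = A n (e n (T n x))
  rw [hT]
  exact (e (n + 1)).apply_symm_apply _

theorem exists_adjoint_inverse {V F : Type*} [NormedAddCommGroup V] [InnerProductSpace ℝ V]
    [NormedAddCommGroup F] [InnerProductSpace ℝ F] [CompleteSpace V] [CompleteSpace F]
    (X : V ≃L[ℝ] F) : ∃ Y : V ≃L[ℝ] F, ∀ x y, inner ℝ (Y y) (X x) = inner ℝ y x := by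
  refine ⟨ContinuousLinearEquiv.equivOfInverse (ContinuousLinearMap.adjoint (X.symm : F →L[ℝ] V))
    (ContinuousLinearMap.adjoint (X : V →L[ℝ] F)) (fun y => ?_) (fun y => ?_), fun x y => ?_⟩
  · refine ext_inner_right ℝ fun z => ?_
    simp [ContinuousLinearMap.adjoint_inner_left]
  · refine ext_inner_right ℝ fun z => ?_
    simp [ContinuousLinearMap.adjoint_inner_left]
  · simp [ContinuousLinearMap.adjoint_inner_left]

/-- Duality reverses direction: a bound for `X` from one time to another bounds `Y` the opposite
way. Test `Y' y` against the `X'`-preimage of itself. -/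
theorem adjoint_norm_le {V F G : Type*} [NormedAddCommGroup V] [InnerProductSpace ℝ V]
    [NormedAddCommGroup F] [InnerProductSpace ℝ F] [NormedAddCommGroup G] [InnerProductSpace ℝ G]
    {X Y : V ≃L[ℝ] F} {X' Y' : V ≃L[ℝ] G} (h : ∀ x y, inner ℝ (Y y) (X x) = inner ℝ y x)
    (h' : ∀ x y, inner ℝ (Y' y) (X' x) = inner ℝ y x) {R : ℝ} (hR : 0 ≤ R)
    (hX : ∀ x, ‖X x‖ ≤ R * ‖X' x‖) (y : V) : ‖Y' y‖ ≤ R * ‖Y y‖ := by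
  rcases (norm_nonneg (Y' y)).eq_or_lt with h0 | h0
  · rw [← h0]
    positivity
  refine le_of_mul_le_mul_right ?_ h0
  set x := X'.symm (Y' y) with hx
  have e : X' x = Y' y := by simp [hx]
  calc ‖Y' y‖ * ‖Y' y‖ = inner ℝ (Y' y) (X' x) := by
        rw [e, real_inner_self_eq_norm_mul_norm]
    _ = inner ℝ (Y y) (X x) := by rw [h', h]
    _ ≤ ‖Y y‖ * ‖X x‖ := real_inner_le_norm _ _
    _ ≤ ‖Y y‖ * (R * ‖X' x‖) := by
        gcongr
        exact hX x
    _ = R * ‖Y y‖ * ‖Y' y‖ := by rw [e]; ring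

end Trivialization

/-! ### Transversality at time `0`, and comparison with arbitrary dichotomies. -/

section Main

variable {V : Type*} [NormedAddCommGroup V] [InnerProductSpace ℝ V]
  {E : ℤ → Type*} [∀ n, NormedAddCommGroup (E n)] [∀ n, InnerProductSpace ℝ (E n)]

/-- Noncriticality on ℤ gives noncriticality on the two half-lines. -/
theorem noncritical_forward {X : ∀ n, V ≃L[ℝ] E n} {n : ℕ} {c : ℝ}
    (h : ∀ (x : V) (i : ℤ), ∑ k ∈ Finset.Ioo i (i + (2 * n : ℕ)), ‖X k x‖ ≤
      c * (‖X i x‖ + ‖X (i + (2 * n : ℕ)) x‖)) (x : V) (i : ℕ) :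
    ∑ k ∈ Finset.Ioo i (i + 2 * n), ‖X k x‖ ≤ c * (‖X i x‖ + ‖X (i + 2 * n : ℕ) x‖) := by
  have h1 := h x i
  rw [norm_apply_congr X (show (i : ℤ) + (2 * n : ℕ) = (i + 2 * n : ℕ) by push_cast; ring)] at h1
  refine le_trans ?_ h1
  rw [← Finset.sum_image (g := fun k : ℕ => (k : ℤ)) (f := fun k => ‖X k x‖)
    (fun a _ b _ hab => by simpa using hab)]
  refine Finset.sum_le_sum_of_subset_of_nonneg ?_ (fun _ _ _ => norm_nonneg _)
  intro k hk
  rw [Finset.mem_image] at hk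
  obtain ⟨a, ha, rfl⟩ := hk
  rw [Finset.mem_Ioo] at ha ⊢
  omega

theorem noncritical_backward {X : ∀ n, V ≃L[ℝ] E n} {n : ℕ} {c : ℝ}
    (h : ∀ (x : V) (i : ℤ), ∑ k ∈ Finset.Ioo i (i + (2 * n : ℕ)), ‖X k x‖ ≤
      c * (‖X i x‖ + ‖X (i + (2 * n : ℕ)) x‖)) (x : V) (i : ℕ) :
    ∑ k ∈ Finset.Ioo i (i + 2 * n), ‖X (-(k : ℤ)) x‖ ≤
      c * (‖X (-(i : ℤ)) x‖ + ‖X (-((i + 2 * n : ℕ) : ℤ)) x‖) := by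
  have h1 := h x (-((i + 2 * n : ℕ) : ℤ))
  rw [norm_apply_congr X (show -((i + 2 * n : ℕ) : ℤ) + (2 * n : ℕ) = -(i : ℤ) by
    push_cast; ring), add_comm ‖X (-((i + 2 * n : ℕ) : ℤ)) x‖] at h1
  refine le_trans ?_ h1
  rw [← Finset.sum_image (g := fun k : ℕ => -(k : ℤ)) (f := fun k => ‖X k x‖)
    (fun a _ b _ hab => by simpa using hab)]
  refine Finset.sum_le_sum_of_subset_of_nonneg ?_ (fun _ _ _ => norm_nonneg _)
  intro k hk
  rw [Finset.mem_image] at hk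
  obtain ⟨a, ha, rfl⟩ := hk
  rw [Finset.mem_Ioo] at ha ⊢
  omega

/-- The half-line dichotomies of a system with slow growth, in general position at time `0`. -/
theorem SlowGrowth.exists_dichotomies [FiniteDimensional ℝ V] {A : ∀ n : ℤ, E n ≃L[ℝ] E (n + 1)}
    {γ : ℝ} (hγ : γ < 1) (h : SlowGrowth A γ) {X Y : ∀ n, V ≃L[ℝ] E n}
    (hX : ∀ n x, X (n + 1) x = A n (X n x))
    (hXY : ∀ k x y, inner ℝ (Y k y) (X k x) = inner ℝ y x) {R : ℝ} (hR : 1 ≤ R)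
    (hf : ∀ x k, ‖X (k + 1) x‖ ≤ R * ‖X k x‖) (hg : ∀ x k, ‖X k x‖ ≤ R * ‖X (k + 1) x‖) :
    ∃ S U : Submodule ℝ V, S ⊔ U = ⊤ ∧
      (∀ W, IsCompl S W → Dichotomy (fun n : ℕ => X n) S W) ∧
      (∀ W, IsCompl U W → Dichotomy (fun n : ℕ => X (-(n : ℤ))) U W) := by
  obtain ⟨L, hL, hw⟩ := h.exists_sum_le hX hXY
  obtain ⟨n₀, hn₀, hs⟩ := exists_scale hγ L
  have hnc : ∀ n, n₀ ≤ n → ∀ (x : V) (i : ℤ), ∑ k ∈ Finset.Ioo i (i + (2 * n : ℕ)), ‖Y k x‖ ≤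
      n / 4 * (‖Y i x‖ + ‖Y (i + (2 * n : ℕ)) x‖) := by
    intro n hn x i
    refine (hw x i (2 * n) (by omega)).trans ?_
    gcongr
    exact hs n hn
  have hYf : ∀ x k, ‖Y (k + 1) x‖ ≤ R * ‖Y k x‖ := fun x k =>
    adjoint_norm_le (hXY k) (hXY (k + 1)) (by linarith) (fun x => hg x k) x
  have hYg : ∀ x k, ‖Y k x‖ ≤ R * ‖Y (k + 1) x‖ := fun x k =>
    adjoint_norm_le (hXY (k + 1)) (hXY k) (by linarith) (fun x => hf x k) x
  have hpf : ∀ x (k : ℕ), ‖Y (k + 1 : ℕ) x‖ ≤ R * ‖Y k x‖ := fun x k => hYf x k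
  have hpg : ∀ x (k : ℕ), ‖Y k x‖ ≤ R * ‖Y (k + 1 : ℕ) x‖ := fun x k => hYg x k
  have hk : ∀ k : ℕ, -((k + 1 : ℕ) : ℤ) + 1 = -(k : ℤ) := fun k => by push_cast; ring
  have hmf : ∀ x (k : ℕ), ‖Y (-((k + 1 : ℕ) : ℤ)) x‖ ≤ R * ‖Y (-(k : ℤ)) x‖ := fun x k => by
    have := hYg x (-((k + 1 : ℕ) : ℤ))
    rwa [norm_apply_congr Y (hk k)] at this
  have hmg : ∀ x (k : ℕ), ‖Y (-(k : ℤ)) x‖ ≤ R * ‖Y (-((k + 1 : ℕ) : ℤ)) x‖ := fun x k => by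
    have := hYf x (-((k + 1 : ℕ) : ℤ))
    rwa [norm_apply_congr Y (hk k)] at this
  have hwp := noncritical_forward (hnc n₀ le_rfl)
  have hwm := noncritical_backward (hnc n₀ le_rfl)
  set P := boundedSubspace (fun n : ℕ => Y n) with hP
  set M := boundedSubspace (fun n : ℕ => Y (-(n : ℤ))) with hM
  refine ⟨Pᗮ, Mᗮ, ?_, fun W hW => ?_, fun W hW => ?_⟩
  -- An adjoint trajectory bounded in both directions decays in both. The estimate on `[-n, n]`
  -- bounds its value at `0` by `n / 4` times its end values, a multiple of that value which is
  -- below 1 for large `n`.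
  · have hPM : P ⊓ M = ⊥ := by
      rw [Submodule.eq_bot_iff]
      rintro x ⟨hxP, hxM⟩
      obtain ⟨C, lam, hC, h0, h1, hS, -⟩ := dichotomy_of_noncritical (fun n : ℕ => Y n) hR hpf hpg
        hn₀ hwp (disjoint_bot_right : Disjoint P ⊥)
      obtain ⟨C', lam', hC', h0', h1', hS', -⟩ := dichotomy_of_noncritical
        (fun n : ℕ => Y (-(n : ℤ))) hR hmf hmg hn₀ hwm (disjoint_bot_right : Disjoint M ⊥)
      set mu := max lam lam' with hmu
      obtain ⟨n, hn, hn1⟩ := exists_mul_pow_lt_one (C + C') (lt_max_of_lt_left h0 : 0 < mu)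
        (max_lt h1 h1') n₀
      have a1 : ‖Y n x‖ ≤ C * mu ^ n * ‖Y 0 x‖ := by
        have := hS 0 n x hxP
        rw [zero_add] at this
        refine this.trans ?_
        change _ ≤ C * mu ^ n * ‖Y ((0 : ℕ) : ℤ) x‖
        gcongr
        exact le_max_left _ _
      have a2 : ‖Y (-n) x‖ ≤ C' * mu ^ n * ‖Y 0 x‖ := by
        have := hS' 0 n x hxM
        rw [zero_add] at this
        refine this.trans ?_
        change _ ≤ C' * mu ^ n * ‖Y (-((0 : ℕ) : ℤ)) x‖
        gcongr
        exact le_max_right _ _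
      have a3 := hnc n hn x (-n)
      rw [norm_apply_congr Y (show -(n : ℤ) + (2 * n : ℕ) = n by push_cast; ring)] at a3
      have a4 : ‖Y 0 x‖ ≤ ∑ k ∈ Finset.Ioo (-(n : ℤ)) (-(n : ℤ) + (2 * n : ℕ)), ‖Y k x‖ :=
        Finset.single_le_sum (f := fun k => ‖Y k x‖) (fun k _ => norm_nonneg _)
          (by rw [Finset.mem_Ioo]; omega)
      have a5 : ‖Y 0 x‖ ≤ 1 / 4 * (n * ((C + C') * mu ^ n)) * ‖Y 0 x‖ := by
        calc ‖Y 0 x‖ ≤ n / 4 * (C' * mu ^ n * ‖Y 0 x‖ + C * mu ^ n * ‖Y 0 x‖) := by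
              refine (a4.trans a3).trans ?_
              gcongr
          _ = _ := by ring
      have a6 : ‖Y 0 x‖ = 0 := by
        have := norm_nonneg (Y 0 x)
        nlinarith
      rwa [norm_eq_zero, map_eq_zero_iff _ (Y 0).injective] at a6
    have h2 : (Pᗮ ⊔ Mᗮ)ᗮ = ⊥ := by
      rw [← Submodule.inf_orthogonal, Submodule.orthogonal_orthogonal,
        Submodule.orthogonal_orthogonal, hPM]
    rwa [Submodule.orthogonal_eq_bot_iff] at h2
  · exact dichotomy_of_adjoint_noncritical (X := fun n : ℕ => X n) (fun k => hXY k) hR hpf hpg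
      hn₀ hwp hW
  · exact dichotomy_of_adjoint_noncritical (X := fun n : ℕ => X (-(n : ℤ))) (fun k => hXY _) hR
      hmf hmg hn₀ hwm hW

theorem transition_fundamental {A : ∀ n : ℤ, E n ≃L[ℝ] E (n + 1)} {X : ∀ n, V ≃L[ℝ] E n}
    (hX : ∀ n x, X (n + 1) x = A n (X n x)) (k : ℤ) (l : ℕ) (x : V) :
    transition A k l (X k x) = X (k + l) x :=
  transition_trajectory A (fun n => X n x) k l fun j _ _ => hX j x

theorem isCompl_map_equiv {S U : Submodule ℝ V} (h : IsCompl S U) {F : Type*}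
    [NormedAddCommGroup F] [InnerProductSpace ℝ F] (X : V ≃L[ℝ] F) :
    IsCompl (S.map X.toLinearEquiv.toLinearMap) (U.map X.toLinearEquiv.toLinearMap) :=
  h.map (Submodule.orderIsoMapComap X.toLinearEquiv)

theorem map_fundamental_succ {A : ∀ n : ℤ, E n ≃L[ℝ] E (n + 1)} {X : ∀ n, V ≃L[ℝ] E n}
    (hX : ∀ n x, X (n + 1) x = A n (X n x)) (S : Submodule ℝ V) (k : ℤ) :
    S.map (X (k + 1)).toLinearEquiv.toLinearMap =
      (S.map (X k).toLinearEquiv.toLinearMap).map (A k).toLinearEquiv.toLinearMap := by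
  rw [← Submodule.map_comp]
  congr 1
  ext x
  exact hX k x

theorem one_div_mul_le_of_le {C c a b : ℝ} (hC : 0 < C) (hc : 0 < c) (h : a ≤ C * c * b) :
    1 / C * c⁻¹ * a ≤ b := by
  rw [one_div, ← mul_inv, inv_mul_le_iff₀ (by positivity)]
  exact h

theorem Dichotomy.isDichotomyPlus {A : ∀ n : ℤ, E n ≃L[ℝ] E (n + 1)} {X : ∀ n, V ≃L[ℝ] E n}
    (hX : ∀ n x, X (n + 1) x = A n (X n x)) {S U : Submodule ℝ V} (hSU : IsCompl S U)
    (h : Dichotomy (fun n : ℕ => X n) S U) :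
    IsDichotomyPlus A (fun k => S.map (X k).toLinearEquiv.toLinearMap)
      (fun k => U.map (X k).toLinearEquiv.toLinearMap) := by
  obtain ⟨C, lam, hC, h0, h1, hS, hU⟩ := h
  refine ⟨C, lam, hC, h0, h1, fun k _ => isCompl_map_equiv hSU (X k),
    fun k _ => map_fundamental_succ hX S k, fun k _ => map_fundamental_succ hX U k, ?_, ?_⟩
  · rintro k l hk _ _ ⟨x, hx, rfl⟩
    obtain ⟨k, rfl⟩ := Int.eq_ofNat_of_zero_le hk
    exact (congrArg norm (transition_fundamental hX k l x)).trans_le (hS k l x hx)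
  · rintro k l hk _ _ ⟨x, hx, rfl⟩
    obtain ⟨k, rfl⟩ := Int.eq_ofNat_of_zero_le hk
    exact (one_div_mul_le_of_le hC (by positivity) (hU k l x hx)).trans_eq
      (congrArg norm (transition_fundamental hX k l x)).symm

theorem Dichotomy.isDichotomyMinus {A : ∀ n : ℤ, E n ≃L[ℝ] E (n + 1)} {X : ∀ n, V ≃L[ℝ] E n}
    (hX : ∀ n x, X (n + 1) x = A n (X n x)) {S U : Submodule ℝ V} (hSU : IsCompl S U)
    (h : Dichotomy (fun n : ℕ => X (-(n : ℤ))) U S) :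
    IsDichotomyMinus A (fun k => S.map (X k).toLinearEquiv.toLinearMap)
      (fun k => U.map (X k).toLinearEquiv.toLinearMap) := by
  obtain ⟨C, lam, hC, h0, h1, hU, hS⟩ := h
  have hk : ∀ (k : ℤ) (l : ℕ), k + l < 0 → ∃ j : ℕ, k + l = -(j : ℤ) ∧ k = -((j + l : ℕ) : ℤ) :=
    fun k l h => ⟨(-(k + l)).toNat, by omega, by omega⟩
  refine ⟨C, lam, hC, h0, h1, fun k _ => isCompl_map_equiv hSU (X k),
    fun k _ => map_fundamental_succ hX S k, fun k _ => map_fundamental_succ hX U k, ?_, ?_⟩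
  · rintro k l _ hkl _ ⟨x, hx, rfl⟩
    obtain ⟨j, h1, h2⟩ := hk k l hkl
    refine (congrArg norm (transition_fundamental hX k l x)).trans_le ?_
    have h3 := hS j l x hx
    rw [← norm_apply_congr X h1, ← norm_apply_congr X h2] at h3
    exact h3
  · rintro k l _ hkl _ ⟨x, hx, rfl⟩
    obtain ⟨j, h1, h2⟩ := hk k l hkl
    have h3 := hU j l x hx
    rw [← norm_apply_congr X h1, ← norm_apply_congr X h2] at h3
    exact (one_div_mul_le_of_le hC (by positivity) h3).trans_eq
      (congrArg norm (transition_fundamental hX k l x)).symm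

theorem exists_mul_pow_lt (C : ℝ) {lam : ℝ} (h0 : 0 < lam) (h1 : lam < 1) {a : ℝ} (ha : 0 < a) :
    ∃ n : ℕ, 0 < n ∧ C * lam ^ n < a := by
  have h2 := (tendsto_pow_atTop_nhds_zero_of_lt_one h0.le h1).const_mul C
  rw [mul_zero] at h2
  obtain ⟨n, hn, hn'⟩ := ((h2.eventually_lt_const ha).and (Filter.eventually_gt_atTop 0)).exists
  exact ⟨n, hn', hn⟩

/-- The stable subspace of a dichotomy on `ℤ⁺` contains all vectors with bounded forward
trajectories. -/
theorem IsDichotomyPlus.mem_of_bounded {A : ∀ n : ℤ, E n ≃L[ℝ] E (n + 1)}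
    {X : ∀ n, V ≃L[ℝ] E n} (hX : ∀ n x, X (n + 1) x = A n (X n x))
    {s u : ∀ k : ℤ, Submodule ℝ (E k)} (h : IsDichotomyPlus A s u) {x : V} {M : ℝ}
    (hM : ∀ n : ℕ, ‖X n x‖ ≤ M) : X 0 x ∈ s 0 := by
  obtain ⟨C, lam, hC, h0, h1, hc, -, -, hs, hu⟩ := h
  obtain ⟨a, ha, b, hb, hab⟩ := Submodule.mem_sup.1
    ((hc 0 le_rfl).sup_eq_top ▸ Submodule.mem_top : X 0 x ∈ s 0 ⊔ u 0)
  obtain ⟨a, rfl⟩ := (X 0).surjective a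
  obtain ⟨b, rfl⟩ := (X 0).surjective b
  have hx : b = x - a := by
    rw [← map_add] at hab
    rw [← (X 0).injective hab]
    abel
  by_contra hxs
  have hb0 : 0 < ‖X 0 b‖ := by
    rw [norm_pos_iff]
    intro hb0
    rw [hb0, add_zero] at hab
    exact hxs (hab ▸ ha)
  -- The unstable component is a bounded trajectory minus a decaying one, hence bounded, against its
  -- exponential growth.
  have hbd : ∀ l : ℕ, 0 < l → ‖X l b‖ ≤ M + C * ‖X 0 a‖ := by
    intro l hl
    have h2 := hs 0 l le_rfl hl _ ha
    rw [transition_fundamental hX, norm_apply_congr X (zero_add _)] at h2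
    have h3 : C * lam ^ l * ‖X 0 a‖ ≤ C * ‖X 0 a‖ := by
      gcongr
      exact mul_le_of_le_one_right hC.le (pow_le_one₀ h0.le h1.le)
    rw [hx, map_sub]
    exact (norm_sub_le _ _).trans (add_le_add (hM l) (h2.trans h3))
  obtain ⟨l, hl, hlt⟩ := exists_mul_pow_lt (C * (M + C * ‖X 0 a‖)) h0 h1 hb0
  have h2 := hu 0 l le_rfl hl _ hb
  rw [transition_fundamental hX, norm_apply_congr X (zero_add _), one_div, ← mul_inv,
    inv_mul_le_iff₀ (by positivity)] at h2
  have h3 : C * lam ^ l * ‖X l b‖ ≤ C * lam ^ l * (M + C * ‖X 0 a‖) := by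
    gcongr
    exact hbd l hl
  nlinarith

/-- The unstable subspace of a dichotomy on `ℤ⁻` contains all vectors with bounded backward
trajectories. -/
theorem IsDichotomyMinus.mem_of_bounded {A : ∀ n : ℤ, E n ≃L[ℝ] E (n + 1)}
    {X : ∀ n, V ≃L[ℝ] E n} (hX : ∀ n x, X (n + 1) x = A n (X n x))
    {s u : ∀ k : ℤ, Submodule ℝ (E k)} (h : IsDichotomyMinus A s u) {x : V} {M : ℝ}
    (hM : ∀ n : ℕ, ‖X (-(n : ℤ)) x‖ ≤ M) : X 0 x ∈ u 0 := by
  obtain ⟨C, lam, hC, h0, h1, hc, hsm, hum, hs, hu⟩ := h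
  have hmem : ∀ t : ∀ k : ℤ, Submodule ℝ (E k),
      (∀ k : ℤ, k < 0 → t (k + 1) = (t k).map (A k).toLinearEquiv.toLinearMap) →
      ∀ y, X 0 y ∈ t 0 → ∀ n : ℕ, X (-(n : ℤ)) y ∈ t (-(n : ℤ)) := by
    intro t ht y hy n
    induction n with
    | zero => exact hy
    | succ n ih =>
      have e : ∀ a b : ℤ, a = b → X a y ∈ t a → X b y ∈ t b := by rintro a _ rfl h; exact h
      have h2 := e _ (-((n + 1 : ℕ) : ℤ) + 1) (by push_cast; ring) ih
      rw [ht _ (by omega), hX] at h2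
      obtain ⟨z, hz, hz'⟩ := h2
      rwa [← (A _).injective hz']
  obtain ⟨a, ha, b, hb, hab⟩ := Submodule.mem_sup.1
    ((hc 0 le_rfl).sup_eq_top ▸ Submodule.mem_top : X 0 x ∈ s 0 ⊔ u 0)
  obtain ⟨a, rfl⟩ := (X 0).surjective a
  obtain ⟨b, rfl⟩ := (X 0).surjective b
  have hx : a = x - b := by
    rw [← map_add] at hab
    rw [← (X 0).injective hab]
    abel
  by_contra hxs
  -- The estimates on `ℤ⁻` require `k + l < 0`, so the comparison ends at time `-1` instead of `0`.
  have ha0 : 0 < ‖X (-1) a‖ := by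
    rw [norm_pos_iff, Ne, map_eq_zero_iff _ (X (-1)).injective]
    rintro rfl
    rw [map_zero, zero_add] at hab
    exact hxs (hab ▸ hb)
  have hidx : ∀ l : ℕ, -((l + 1 : ℕ) : ℤ) + l = -1 := fun l => by push_cast; ring
  have hbd : ∀ l : ℕ, 0 < l → ‖X (-((l + 1 : ℕ) : ℤ)) a‖ ≤ M + C * ‖X (-1) b‖ := by
    intro l hl
    have h2 := hu _ l hl (by rw [hidx]; norm_num) _ (hmem u hum b hb (l + 1))
    rw [transition_fundamental hX, norm_apply_congr X (hidx l), one_div, ← mul_inv,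
      inv_mul_le_iff₀ (by positivity)] at h2
    have h3 : C * lam ^ l * ‖X (-1) b‖ ≤ C * ‖X (-1) b‖ := by
      gcongr
      exact mul_le_of_le_one_right hC.le (pow_le_one₀ h0.le h1.le)
    rw [hx, map_sub]
    exact (norm_sub_le _ _).trans (add_le_add (hM (l + 1)) (h2.trans h3))
  obtain ⟨l, hl, hlt⟩ := exists_mul_pow_lt (C * (M + C * ‖X (-1) b‖)) h0 h1 ha0
  have h2 := hs _ l hl (by rw [hidx]; norm_num) _ (hmem s hsm a ha (l + 1))
  rw [transition_fundamental hX, norm_apply_congr X (hidx l)] at h2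
  have h3 : C * lam ^ l * ‖X (-((l + 1 : ℕ) : ℤ)) a‖ ≤ C * lam ^ l * (M + C * ‖X (-1) b‖) := by
    gcongr
    exact hbd l hl
  nlinarith

theorem Dichotomy.bounded {F : ℕ → Type*} [∀ n, NormedAddCommGroup (F n)]
    [∀ n, InnerProductSpace ℝ (F n)] {X : ∀ n, V ≃L[ℝ] F n} {S U : Submodule ℝ V}
    (h : Dichotomy X S U) {x : V} (hx : x ∈ S) : ∃ M : ℝ, ∀ n, ‖X n x‖ ≤ M := by
  obtain ⟨C, lam, hC, h0, h1, hS, -⟩ := h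
  refine ⟨C * ‖X 0 x‖, fun n => ?_⟩
  have h2 := hS 0 n x hx
  rw [zero_add] at h2
  refine h2.trans ?_
  gcongr
  exact mul_le_of_le_one_right hC.le (pow_le_one₀ h0.le h1.le)

end Main

end LinSeq

theorem theorem5 {E : ℤ → Type*} [∀ n, NormedAddCommGroup (E n)]
    [∀ n, InnerProductSpace ℝ (E n)] [∀ n, FiniteDimensional ℝ (E n)]
    (m : ℕ) (hm : ∀ n, Module.finrank ℝ (E n) = m)
    (A : ∀ n : ℤ, E n ≃L[ℝ] E (n + 1)) (R : ℝ) (hR : 0 < R)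
    (hA : ∀ n, ‖(A n : E n →L[ℝ] E (n + 1))‖ < R)
    (hA' : ∀ n, ‖((A n).symm : E (n + 1) →L[ℝ] E n)‖ < R) :
    (LinSeq.SublinearGrowth A →
      (LinSeq.ExpDichotomyPlus A ∧ LinSeq.ExpDichotomyMinus A) ∧
      ∀ sPlus uPlus sMinus uMinus : ∀ k : ℤ, Submodule ℝ (E k),
        LinSeq.IsDichotomyPlus A sPlus uPlus → LinSeq.IsDichotomyMinus A sMinus uMinus →
          sPlus 0 ⊔ uMinus 0 = ⊤) ∧
    (LinSeq.SublinearGrowth A ↔ LinSeq.BoundedSolution A) := by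
  obtain ⟨X, hX⟩ := LinSeq.exists_fundamental_solution hm A
  have : ∀ n, CompleteSpace (E n) := fun n => FiniteDimensional.complete ℝ (E n)
  choose Y hXY using fun n => LinSeq.exists_adjoint_inverse (X n)
  -- Powers of the step bound have to be monotone in the exponent, hence a bound at least 1.
  have hR1 : 1 ≤ max 1 R := le_max_left _ _
  have hf : ∀ x k, ‖X (k + 1) x‖ ≤ max 1 R * ‖X k x‖ := fun x k => by
    rw [hX]
    exact (A k : E k →L[ℝ] E (k + 1)).le_of_opNorm_le ((hA k).le.trans (le_max_right _ _)) (X k x)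
  have hg : ∀ x k, ‖X k x‖ ≤ max 1 R * ‖X (k + 1) x‖ := fun x k => by
    have h1 := ((A k).symm : E (k + 1) →L[ℝ] E k).le_of_opNorm_le
      ((hA' k).le.trans (le_max_right 1 _)) (X (k + 1) x)
    have h2 : ((A k).symm : E (k + 1) →L[ℝ] E k) (X (k + 1) x) = X k x := by simp [hX]
    rwa [h2] at h1
  have main : LinSeq.SublinearGrowth A → _ := fun ⟨γ, _, hγ, h⟩ =>
    h.exists_dichotomies hγ hX hXY hR1 hf hg
  refine ⟨fun h => ?_, fun h => ?_, fun h => ⟨0, le_rfl, one_pos, h⟩⟩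
  · obtain ⟨S, U, hSU, hp, hm⟩ := main h
    obtain ⟨W, hW⟩ := exists_isCompl S
    obtain ⟨T, hT⟩ := exists_isCompl U
    refine ⟨⟨⟨_, _, (hp W hW).isDichotomyPlus hX hW⟩,
      ⟨_, _, (hm T hT).isDichotomyMinus hX hT.symm⟩⟩, fun s u s' u' h1 h2 => ?_⟩
    rw [eq_top_iff]
    intro y _
    obtain ⟨x, rfl⟩ := (X 0).surjective y
    -- The summands have bounded forward and backward trajectories respectively, so they lie in the
    -- stable and unstable spaces of any choice of dichotomies.
    obtain ⟨a, ha, b, hb, rfl⟩ := Submodule.mem_sup.1 (hSU ▸ Submodule.mem_top : x ∈ S ⊔ U)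
    obtain ⟨M, hM⟩ := (hp W hW).bounded ha
    obtain ⟨M', hM'⟩ := (hm T hT).bounded hb
    rw [map_add]
    exact Submodule.add_mem_sup (h1.mem_of_bounded hX hM) (h2.mem_of_bounded hX hM')
  · obtain ⟨S, U, hSU, hp, hm⟩ := main h
    exact LinSeq.boundedSolution_of_splitting hX (LinSeq.exists_splitting hR1 hf hg hSU hp hm)
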